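/- Write $\mathbb C_+=\{z\in\mathbb C:\operatorname{Im}z>0\}$ and $f^\#(z)=\overline{f(\bar z)}$, and let $H^2(\mathbb C_+)$ be the Hardy space of holomorphic functions $F$ on $\mathbb C_+$ with $\sup_{y>0}\int_{\mathbb R}|F(x+iy)|^2\,dx<\infty$. Let $E$ be an entire function of Hermite–Biehler class, i.e. $|E(\bar z)|<|E(z)|$ for all $z\in\mathbb C_+$, and let $H(E)$ be the de Branges space of all entire functions $f$ with $f/E,\ f^\#/E\in H^2(\mathbb C_+)$, normed by $\|f\|^2=\int_{\mathbb R}|f(t)/E(t)|^2\,dt$. Put $\chi=E^\#/E$. Let $\varphi$ be an entire function and $\Lambda=\{z\in\mathbb C_+: E(\varphi(z))\neq 0\}$. If the composition operator $C_\varphi f=f\circ\varphi$ is bounded on $H(E)$ (that is, it maps $H(E)$ into itself and $\|f\circ\varphi\|\le C\|f\|$ for some constant $C$ and all $f\in H(E)$), then $$\sup_{z\in\Lambda}\ \frac{\operatorname{Im}z}{\operatorname{Im}\varphi(z)}\left|\frac{E(\varphi(z))}{E(z)}\right|^2\frac{1-|\chi(\varphi(z))|^2}{1-|\chi(z)|^2}<\infty,$$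 where, at points $z\in\Lambda$ with $\varphi(z)\in\mathbb R$, the quotient $\dfrac{1-|\chi(w)|^2}{\operatorname{Im}w}$ at $w=\varphi(z)$ is understood as its limiting value $2|\chi'(w)|$. Moreover, if $\varphi(\mathbb C_+)\subseteq\mathbb C_+$, then $\Lambda=\mathbb C_+$. -/

import Mathlib

open scoped ComplexConjugate NNReal ENNReal

namespace DeBranges

/-- The open upper half-plane `ℂ₊`. -/
def upperHalf : Set ℂ := {z | 0 < z.im}

/-- `f^#(z) = conj (f (conj z))`. -/
noncomputable def sharp (f : ℂ → ℂ) : ℂ → ℂ := fun z => conj (f (conj z))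

/-- The Hermite–Biehler class: entire functions `E` with `|E(conj z)| < |E(z)|` on `ℂ₊`. -/
def HermiteBiehler (E : ℂ → ℂ) : Prop :=
  Differentiable ℂ E ∧ ∀ z ∈ upperHalf, ‖E (conj z)‖ < ‖E z‖

/-- The Hardy space `H²(ℂ₊)`: functions holomorphic in `ℂ₊` whose square integrals along
horizontal lines are uniformly bounded. Only the values of `F` on `ℂ₊` matter. -/
def MemHardyTwo (F : ℂ → ℂ) : Prop :=
  DifferentiableOn ℂ F upperHalf ∧
    ∃ C : ℝ≥0, ∀ y : ℝ, 0 < y →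
      ∫⁻ x : ℝ, ‖F ((x : ℂ) + (y : ℂ) * Complex.I)‖ₑ ^ 2 ≤ (C : ℝ≥0∞)

/-- The de Branges space `H(E)`: entire `f` with `f / E` and `f^# / E` in `H²(ℂ₊)`. -/
def space (E : ℂ → ℂ) : Set (ℂ → ℂ) :=
  {f | Differentiable ℂ f ∧ MemHardyTwo (fun z => f z / E z) ∧
    MemHardyTwo (fun z => sharp f z / E z)}

/-- The norm of `H(E)`, `(∫_ℝ |f(t) / E(t)|² dt)^{1/2}`, with values in `[0, ∞]`
(it is finite on `H(E)`). -/
noncomputable def spaceNorm (E f : ℂ → ℂ) : ℝ≥0∞ :=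
  (∫⁻ t : ℝ, ‖f (t : ℂ) / E (t : ℂ)‖ₑ ^ 2) ^ (1 / 2 : ℝ)

/-- The composition operator `f ↦ f ∘ φ` is a bounded operator on `H(E)`. -/
def BoundedComposition (E φ : ℂ → ℂ) : Prop :=
  (∀ f ∈ space E, f ∘ φ ∈ space E) ∧
    ∃ C : ℝ≥0, ∀ f ∈ space E, spaceNorm E (f ∘ φ) ≤ C * spaceNorm E f

/-- `χ = E^# / E`. -/
noncomputable def chi (E : ℂ → ℂ) : ℂ → ℂ := fun z => sharp E z / E z

/-- `Λ = {z ∈ ℂ₊ : E(φ(z)) ≠ 0}`. -/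
def regularSet (E φ : ℂ → ℂ) : Set ℂ := {z | z ∈ upperHalf ∧ E (φ z) ≠ 0}

/-- `(1 - |χ(w)|²) / Im w`, extended to real `w` by its limit there, which is `2 |χ'(w)|`
because `|χ| = 1` on the real line. -/
noncomputable def defectQuotient (E : ℂ → ℂ) (w : ℂ) : ℝ :=
  if w.im = 0 then 2 * ‖deriv (chi E) w‖ else (1 - ‖chi E w‖ ^ 2) / w.im

/-- The quantity
`(Im z / Im φ(z)) * |E(φ(z)) / E(z)|² * (1 - |χ(φ(z))|²) / (1 - |χ(z)|²)`, where the factor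
`(1 - |χ(φ(z))|²) / Im φ(z)`, of the form `0 / 0` when `φ(z)` is real, is continuously
extended to such points. -/
noncomputable def weight (E φ : ℂ → ℂ) (z : ℂ) : ℝ :=
  ‖E (φ z) / E z‖ ^ 2 * (z.im * defectQuotient E (φ z) / (1 - ‖chi E z‖ ^ 2))

/-- Off the set where `φ` is real, `weight` is given by the displayed formula. -/
theorem weight_eq (E φ : ℂ → ℂ) (z : ℂ) (h : (φ z).im ≠ 0) :
    weight E φ z = z.im / (φ z).im * ‖E (φ z) / E z‖ ^ 2 *
      ((1 - ‖chi E (φ z)‖ ^ 2) / (1 - ‖chi E z‖ ^ 2)) := by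
  simp only [weight, defectQuotient, if_neg h]
  ring

end DeBranges

/-! `H(E)` has a reproducing kernel `K_w` at each `w` in the upper half-plane, with `4π K_w(w) =
(|E(w)|² - |E(conj w)|²) / Im w`, called `diagonal E w` below. Factoring `|E|²` out turns this into
`|E(w)|² (1 - |χ(w)|²) / Im w`, so the weight at `z` is the quotient of the diagonals at `φ(z)` and
at `z`. Boundedness with constant `C` gives `|K_w(φ(z))| ≤ C ‖K_w‖ ‖K_z‖`. Taking `w = φ(z)` and
cancelling yields `K_w(w) ≤ C² K_z(z)`, so the supremum is at most `C²`.

Kernels are used only at points of the upper half-plane. If `φ(z)` lies below the real line, the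
test function is `K_w^#` with `w = conj φ(z)`, which has the same norm as `K_w`. If `φ(z) = u` is
real, the test functions are `K_{u+iε}` with `ε → 0+`: both `4π |K_{u+iε}(u)|` and the diagonal at
`u + iε` tend to `2 |E(u)|² |χ'(u)|`.

The analytic weight is carried by `HermiteBiehler.reproducing`, which rests on Cauchy's formula for
boundary values of `H²` functions (`MemHardyTwo.boundary`). That formula is proved on horizontal
lines by shifting contours and then transferred to the real axis by weak convergence in `L²`. -/

namespace DeBranges

open MeasureTheory Filter Topology Complex

/-! ### Shifting horizontal contours -/

/-- The vertical sides of a rectangle contribute an integrable function of their abscissa. -/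
theorem lintegral_enorm_vertical_le {G : ℂ → ℂ} {h y : ℝ} (hy : h ≤ y)
    (hG : DifferentiableOn ℂ G {z | h ≤ z.im}) {B : ℝ≥0∞}
    (hbd : ∀ s : ℝ, h ≤ s → ∫⁻ x : ℝ, ‖G ((x : ℂ) + (s : ℂ) * I)‖ₑ ≤ B) :
    ∫⁻ x : ℝ, ‖∫ s : ℝ in h..y, G ((x : ℂ) + (s : ℂ) * I)‖ₑ ≤ B * ENNReal.ofReal (y - h) := by
  -- Clamping the height by `max` gives a jointly continuous function on the whole plane that agrees
  -- with `G` on the strip, so Tonelli applies.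
  have hcont : Continuous fun q : ℝ × ℝ => G ((q.1 : ℂ) + ((max q.2 h : ℝ) : ℂ) * I) := by
    refine hG.continuousOn.comp_continuous (by fun_prop) fun q => ?_
    simp
  calc ∫⁻ x : ℝ, ‖∫ s : ℝ in h..y, G ((x : ℂ) + (s : ℂ) * I)‖ₑ
      ≤ ∫⁻ x : ℝ, ∫⁻ s : ℝ in Set.Ioc h y, ‖G ((x : ℂ) + ((max s h : ℝ) : ℂ) * I)‖ₑ := by
        refine lintegral_mono fun x => ?_
        rw [intervalIntegral.integral_of_le hy]
        refine (enorm_integral_le_lintegral_enorm _).trans (le_of_eq ?_)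
        refine setLIntegral_congr_fun measurableSet_Ioc fun s hs => ?_
        simp only [max_eq_left hs.1.le]
    _ = ∫⁻ s : ℝ in Set.Ioc h y, ∫⁻ x : ℝ, ‖G ((x : ℂ) + ((max s h : ℝ) : ℂ) * I)‖ₑ :=
        lintegral_lintegral_swap hcont.enorm.measurable.aemeasurable
    _ ≤ ∫⁻ _ in Set.Ioc h y, B := lintegral_mono fun s => hbd _ (le_max_right _ _)
    _ = B * ENNReal.ofReal (y - h) := by simp

theorem integrable_horizontal {G : ℂ → ℂ} {h s : ℝ}
    (hG : DifferentiableOn ℂ G {z | h ≤ z.im}) {B : ℝ≥0∞} (hB : B ≠ ∞)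
    (hbd : ∀ s : ℝ, h ≤ s → ∫⁻ x : ℝ, ‖G ((x : ℂ) + (s : ℂ) * I)‖ₑ ≤ B) (hs : h ≤ s) :
    Integrable fun x : ℝ => G ((x : ℂ) + (s : ℂ) * I) := by
  refine ⟨?_, (hbd s hs).trans_lt hB.lt_top⟩
  refine (hG.continuousOn.comp_continuous (by fun_prop) fun x => ?_).aestronglyMeasurable
  simpa using hs

/-- The integral along horizontal lines of a function that is holomorphic above height `h` and
uniformly integrable on those lines does not depend on the line. -/
theorem integral_horizontal_eq {G : ℂ → ℂ} {h y : ℝ} (hy : h ≤ y)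
    (hG : DifferentiableOn ℂ G {z | h ≤ z.im}) {B : ℝ≥0∞} (hB : B ≠ ∞)
    (hbd : ∀ s : ℝ, h ≤ s → ∫⁻ x : ℝ, ‖G ((x : ℂ) + (s : ℂ) * I)‖ₑ ≤ B) :
    ∫ x : ℝ, G ((x : ℂ) + (h : ℂ) * I) = ∫ x : ℝ, G ((x : ℂ) + (y : ℂ) * I) := by
  set V : ℝ → ℂ := fun x => ∫ s : ℝ in h..y, G ((x : ℂ) + (s : ℂ) * I) with hV
  have hVint : ∫⁻ x : ℝ, ‖V x‖ₑ ≤ B * ENNReal.ofReal (y - h) :=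
    lintegral_enorm_vertical_le hy hG hbd
  have hVneg : ∫⁻ x : ℝ, ‖V (-x)‖ₑ ≤ B * ENNReal.ofReal (y - h) := by
    rwa [lintegral_neg_eq_self (fun x => ‖V x‖ₑ)]
  have hfin : B * ENNReal.ofReal (y - h) ≠ ∞ := ENNReal.mul_ne_top hB ENNReal.ofReal_ne_top
  have hrect : ∀ R : ℝ, (∫ x : ℝ in (-R)..R, G ((x : ℂ) + (h : ℂ) * I)) -
      (∫ x : ℝ in (-R)..R, G ((x : ℂ) + (y : ℂ) * I)) = I * V (-R) - I * V R := by
    intro R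
    have := integral_boundary_rect_eq_zero_of_differentiableOn G (⟨-R, h⟩ : ℂ) (⟨R, y⟩ : ℂ)
      (hG.mono fun z hz => by
        have := (mem_reProdIm.1 hz).2
        rw [Set.uIcc_of_le hy] at this
        exact this.1)
    simp only [smul_eq_mul] at this
    simp only [hV]
    push_cast at this ⊢
    linear_combination this
  -- No pointwise decay of `V` is known, only integrability. If the two line integrals differed, `‖V
  -- (-R)‖ + ‖V R‖` would stay above a positive constant for all large `R`, making its integral
  -- infinite.
  by_contra hne
  set L : ℂ := (∫ x : ℝ, G ((x : ℂ) + (h : ℂ) * I)) - ∫ x : ℝ, G ((x : ℂ) + (y : ℂ) * I) with hL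
  have hL0 : 0 < ‖L‖ := norm_pos_iff.2 (sub_ne_zero.2 hne)
  have hlim : Tendsto (fun R : ℝ => ‖I * V (-R) - I * V R‖) atTop (𝓝 ‖L‖) := by
    simp_rw [← hrect]
    exact ((intervalIntegral_tendsto_integral (integrable_horizontal hG hB hbd le_rfl)
      tendsto_neg_atTop_atBot tendsto_id).sub (intervalIntegral_tendsto_integral
      (integrable_horizontal hG hB hbd hy) tendsto_neg_atTop_atBot tendsto_id)).norm
  obtain ⟨R₀, hR₀⟩ := eventually_atTop.1 (hlim.eventually (lt_mem_nhds (half_lt_self hL0)))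
  have hVmeas : Measurable fun x : ℝ => ‖V (-x)‖ₑ := by
    have hcont : Continuous fun q : ℝ × ℝ => G ((q.1 : ℂ) + ((max q.2 h : ℝ) : ℂ) * I) := by
      refine hG.continuousOn.comp_continuous (by fun_prop) fun q => ?_
      simp
    have : V = fun x : ℝ => ∫ s : ℝ in h..y, G ((x : ℂ) + ((max s h : ℝ) : ℂ) * I) := by
      funext x
      refine intervalIntegral.integral_congr fun s hs => ?_
      rw [Set.uIcc_of_le hy] at hs
      simp only [max_eq_left hs.1]
    have hVc : Continuous V := by
      rw [this]
      exact intervalIntegral.continuous_parametric_intervalIntegral_of_continuous' hcont h y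
    exact (hVc.comp continuous_neg).enorm.measurable
  have hge : (∞ : ℝ≥0∞) ≤ B * ENNReal.ofReal (y - h) + B * ENNReal.ofReal (y - h) := by
    calc (∞ : ℝ≥0∞) = ∫⁻ _ in Set.Ici R₀, ENNReal.ofReal (‖L‖ / 2) := by
          have : ENNReal.ofReal (‖L‖ / 2) ≠ 0 := by simpa using norm_pos_iff.1 hL0
          simp only [lintegral_const, Measure.restrict_apply_univ, Real.volume_Ici]
          rw [ENNReal.mul_top this]
      _ ≤ ∫⁻ R in Set.Ici R₀, (‖V (-R)‖ₑ + ‖V R‖ₑ) := by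
          refine setLIntegral_mono' measurableSet_Ici fun R hR => ?_
          have h1 := (hR₀ R hR).le.trans (norm_sub_le _ _)
          simp only [norm_mul, norm_I, one_mul] at h1
          rw [← ofReal_norm, ← ofReal_norm,
            ← ENNReal.ofReal_add (norm_nonneg _) (norm_nonneg _)]
          exact ENNReal.ofReal_le_ofReal h1
      _ ≤ ∫⁻ R, (‖V (-R)‖ₑ + ‖V R‖ₑ) := setLIntegral_le_lintegral _ _
      _ = (∫⁻ R, ‖V (-R)‖ₑ) + ∫⁻ R, ‖V R‖ₑ := lintegral_add_left hVmeas _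
      _ ≤ _ := add_le_add hVneg hVint
  exact (ENNReal.add_ne_top.2 ⟨hfin, hfin⟩) (top_le_iff.1 hge)

theorem integral_horizontal_eq_zero {G : ℂ → ℂ} {h : ℝ}
    (hG : DifferentiableOn ℂ G {z | h ≤ z.im}) {B : ℝ≥0∞} (hB : B ≠ ∞)
    (hbd : ∀ s : ℝ, h ≤ s → ∫⁻ x : ℝ, ‖G ((x : ℂ) + (s : ℂ) * I)‖ₑ ≤ B)
    (hdecay : ∀ ε : ℝ≥0∞, 0 < ε → ∃ y, h ≤ y ∧ ∫⁻ x : ℝ, ‖G ((x : ℂ) + (y : ℂ) * I)‖ₑ ≤ ε) :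
    ∫ x : ℝ, G ((x : ℂ) + (h : ℂ) * I) = 0 := by
  rw [← enorm_eq_zero, ← le_zero_iff]
  refine le_of_forall_gt_imp_ge_of_dense fun ε hε => ?_
  obtain ⟨y, hy, hle⟩ := hdecay ε hε
  rw [integral_horizontal_eq hy hG hB hbd]
  exact (enorm_integral_le_lintegral_enorm _).trans hle

/-! ### Square-integral estimates for Cauchy kernels -/

/-- Cauchy–Schwarz for lower integrals of norms. -/
theorem lintegral_enorm_mul_le {f g : ℝ → ℂ} (hf : AEMeasurable f) (hg : AEMeasurable g)
    {μ : Measure ℝ} (hμ : μ ≤ volume) :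
    ∫⁻ x, ‖f x * g x‖ₑ ∂μ ≤
      (∫⁻ x, ‖f x‖ₑ ^ 2 ∂μ) ^ (1 / 2 : ℝ) * (∫⁻ x, ‖g x‖ₑ ^ 2 ∂μ) ^ (1 / 2 : ℝ) := by
  have h := ENNReal.lintegral_mul_le_Lp_mul_Lq μ Real.HolderConjugate.two_two
    (hf.enorm.mono_measure hμ) (hg.enorm.mono_measure hμ)
  simpa [enorm_mul] using h

theorem lintegral_inv_one_add_sq (u : ℝ) :
    ∫⁻ x : ℝ, ENNReal.ofReal (1 + (x - u) ^ 2)⁻¹ = ENNReal.ofReal Real.pi := by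
  have h := lintegral_sub_right_eq_self (μ := volume)
    (fun x : ℝ => ENNReal.ofReal (1 + x ^ 2)⁻¹) u
  rw [h, ← integral_univ_inv_one_add_sq, ofReal_integral_eq_lintegral_ofReal
    integrable_inv_one_add_sq (Eventually.of_forall fun x => by positivity)]

theorem integrable_and_integral_inv_sq_add_sq (u : ℝ) {v : ℝ} (hv : 0 < v) :
    Integrable (fun x : ℝ => ((x - u) ^ 2 + v ^ 2)⁻¹) ∧
      ∫ x : ℝ, ((x - u) ^ 2 + v ^ 2)⁻¹ = Real.pi / v := by
  have h1 : ∀ x : ℝ, ((x - u) ^ 2 + v ^ 2)⁻¹ = (v ^ 2)⁻¹ * (1 + (v⁻¹ * (x - u)) ^ 2)⁻¹ := by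
    intro x
    field_simp
    ring
  constructor
  · simp_rw [h1]
    exact (((integrable_inv_one_add_sq.comp_mul_left' (inv_ne_zero hv.ne')).comp_sub_right
      u).const_mul _)
  · simp_rw [h1]
    rw [integral_const_mul, integral_sub_right_eq_self (fun x : ℝ => (1 + (v⁻¹ * x) ^ 2)⁻¹) u,
      Measure.integral_comp_mul_left (fun x : ℝ => (1 + x ^ 2)⁻¹), integral_univ_inv_one_add_sq,
      inv_inv, abs_of_pos hv, smul_eq_mul]
    field_simp

theorem lintegral_enorm_inv_sub_sq (p : ℂ) {y : ℝ} (hy : p.im < y) :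
    ∫⁻ x : ℝ, ‖((x : ℂ) + (y : ℂ) * I - p)⁻¹‖ₑ ^ 2 = ENNReal.ofReal (Real.pi / (y - p.im)) := by
  have hv : 0 < y - p.im := sub_pos.2 hy
  obtain ⟨hi, he⟩ := integrable_and_integral_inv_sq_add_sq p.re hv
  rw [← he, ofReal_integral_eq_lintegral_ofReal hi (Eventually.of_forall fun x => by positivity)]
  refine lintegral_congr fun x => ?_
  rw [← ofReal_norm, ← ENNReal.ofReal_pow (norm_nonneg _), norm_inv, inv_pow,
    ← normSq_eq_norm_sq, normSq_apply]
  congr 2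
  simp
  ring

/-! ### Cauchy's formula for `H²` on horizontal lines -/

theorem isOpen_upperHalf : IsOpen upperHalf := isOpen_lt continuous_const continuous_im

theorem MemHardyTwo.continuous_horizontal {F : ℂ → ℂ} (hF : MemHardyTwo F) {y : ℝ} (hy : 0 < y) :
    Continuous fun x : ℝ => F ((x : ℂ) + (y : ℂ) * I) :=
  hF.1.continuousOn.comp_continuous (by fun_prop) fun x => by simpa [upperHalf] using hy

/-- With the pole below the line, the contour can be pushed up to infinity: by Cauchy–Schwarz the
line integral of the norm at height `s` is `O((s - Im p)^(-1/2))`. -/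
theorem MemHardyTwo.integral_mul_inv_eq_zero {F : ℂ → ℂ} (hF : MemHardyTwo F) {h : ℝ} (hh : 0 < h)
    {p : ℂ} (hp : p.im < h) :
    ∫ x : ℝ, F ((x : ℂ) + (h : ℂ) * I) * ((x : ℂ) + (h : ℂ) * I - p)⁻¹ = 0 := by
  obtain ⟨C, hC⟩ := hF.2
  have hline : ∀ s : ℝ, h ≤ s →
      ∫⁻ x : ℝ, ‖F ((x : ℂ) + (s : ℂ) * I) * ((x : ℂ) + (s : ℂ) * I - p)⁻¹‖ₑ ≤
        (C : ℝ≥0∞) ^ (1 / 2 : ℝ) * ENNReal.ofReal (Real.pi / (s - p.im)) ^ (1 / 2 : ℝ) := by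
    intro s hs
    have hps : p.im < s := hp.trans_le hs
    refine (lintegral_enorm_mul_le
      (hF.continuous_horizontal (hh.trans_le hs)).measurable.aemeasurable
      (Measurable.aemeasurable (by fun_prop)) le_rfl).trans ?_
    rw [lintegral_enorm_inv_sub_sq p hps]
    gcongr
    exact hC s (hh.trans_le hs)
  refine integral_horizontal_eq_zero (G := fun z => F z * (z - p)⁻¹)
    (B := (C : ℝ≥0∞) ^ (1 / 2 : ℝ) * ENNReal.ofReal (Real.pi / (h - p.im)) ^ (1 / 2 : ℝ))
    ?_ ?_ ?_ ?_
  · refine (hF.1.mono fun z hz => hh.trans_le hz).mul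
      (DifferentiableOn.inv (by fun_prop) fun z hz hzp => ?_)
    rw [sub_eq_zero] at hzp
    subst hzp
    exact absurd hz (not_le.2 hp)
  · refine ENNReal.mul_ne_top ?_ ?_ <;>
      exact ENNReal.rpow_ne_top_of_nonneg (by norm_num) (by simp)
  · intro s hs
    refine (hline s hs).trans ?_
    gcongr
  · intro ε hε
    have hlim : Tendsto (fun s : ℝ => (C : ℝ≥0∞) ^ (1 / 2 : ℝ) *
        ENNReal.ofReal (Real.pi / (s - p.im)) ^ (1 / 2 : ℝ)) atTop (𝓝 0) := by
      have h1 : Tendsto (fun s : ℝ => Real.pi / (s - p.im)) atTop (𝓝 0) :=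
        tendsto_const_nhds.div_atTop (tendsto_atTop_add_const_right _ _ tendsto_id)
      have h2 := ((ENNReal.continuous_rpow_const (y := 1 / 2)).tendsto _).comp
        (ENNReal.tendsto_ofReal h1)
      have h3 := ENNReal.Tendsto.const_mul (a := (C : ℝ≥0∞) ^ (1 / 2 : ℝ)) h2
        (Or.inr (ENNReal.rpow_ne_top_of_nonneg (by norm_num) (by simp)))
      simpa using h3
    obtain ⟨y, hy, hle⟩ := ((eventually_ge_atTop h).and (hlim.eventually (gt_mem_nhds hε))).exists
    exact ⟨y, hy, (hline y hy).trans hle.le⟩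

theorem integrable_mul_of_lintegral_sq_ne_top {f g : ℝ → ℂ} (hf : AEMeasurable f)
    (hg : AEMeasurable g) (hf2 : ∫⁻ x, ‖f x‖ₑ ^ 2 ≠ ∞) (hg2 : ∫⁻ x, ‖g x‖ₑ ^ 2 ≠ ∞) :
    Integrable fun x => f x * g x := by
  refine ⟨(hf.mul hg).aestronglyMeasurable, (lintegral_enorm_mul_le hf hg le_rfl).trans_lt ?_⟩
  exact ENNReal.mul_lt_top (ENNReal.rpow_lt_top_of_nonneg (by norm_num) hf2)
    (ENNReal.rpow_lt_top_of_nonneg (by norm_num) hg2)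

theorem lintegral_enorm_inv_sub_sq_ne_top {p : ℂ} (hp : p.im ≠ 0) :
    ∫⁻ x : ℝ, ‖((x : ℂ) - p)⁻¹‖ₑ ^ 2 ≠ ∞ := by
  have key : ∀ q : ℂ, q.im < 0 → ∫⁻ x : ℝ, ‖((x : ℂ) - q)⁻¹‖ₑ ^ 2 ≠ ∞ := fun q hq => by
    have := lintegral_enorm_inv_sub_sq q hq
    simp only [ofReal_zero, zero_mul, add_zero] at this
    rw [this]
    exact ENNReal.ofReal_ne_top
  rcases lt_or_gt_of_ne hp with hp | hp
  · exact key p hp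
  · have h : ∀ x : ℝ, ‖((x : ℂ) - p)⁻¹‖ₑ = ‖((x : ℂ) - conj p)⁻¹‖ₑ := fun x => by
      rw [← ofReal_norm, ← ofReal_norm, norm_inv, norm_inv, ← norm_conj ((x : ℂ) - p)]
      simp
    simp_rw [h]
    exact key _ (by simpa using hp)

/-- A holomorphic function on the half-plane dominated by `(‖F z‖ + const) / ‖z - p‖` with
`F ∈ H²` is in `H²`; near `p` nothing has to be assumed. -/
theorem MemHardyTwo.of_norm_mul_sub_le {F G : ℂ → ℂ} (hF : MemHardyTwo F)
    (hG : DifferentiableOn ℂ G upperHalf) {p : ℂ} (hp : p ∈ upperHalf) {B : ℝ}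
    (hbd : ∀ z ∈ upperHalf, ‖G z * (z - p)‖ ≤ ‖F z‖ + B) : MemHardyTwo G := by
  have hp' : 0 < p.im := hp
  set δ := p.im / 2 with hδ
  have hδ0 : 0 < δ := half_pos hp'
  -- Half the height of `p` keeps the closed disc inside the half-plane, so `G` is bounded there by
  -- compactness.
  have hsub : Metric.closedBall p δ ⊆ upperHalf := by
    intro z hz
    rw [Metric.mem_closedBall, dist_eq_norm] at hz
    have := (abs_le.1 ((abs_im_le_norm (z - p)).trans hz)).1
    simp only [sub_im] at this
    simp only [upperHalf, Set.mem_ofPred_eq]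
    linarith
  obtain ⟨M, hM⟩ := (isCompact_closedBall p δ).exists_bound_of_continuousOn
    (hG.continuousOn.mono hsub)
  -- The first summand of `c` serves the disc, where `(Re (z - p))² ≤ δ²`. The constant `a` and the
  -- second summand serve its complement, through `(‖F‖ + B)² ≤ 2‖F‖² + 2B²` and `1 + (Re (z - p))²
  -- ≤ (1 + 1/δ²) ‖z - p‖²`.
  set a : ℝ := 2 / δ ^ 2
  set c : ℝ := M ^ 2 * (1 + δ ^ 2) + 2 * B ^ 2 * (1 + 1 / δ ^ 2)
  have hc : 0 ≤ c := by positivity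
  have key : ∀ z ∈ upperHalf, ‖G z‖ ^ 2 ≤ a * ‖F z‖ ^ 2 + c * (1 + (z.re - p.re) ^ 2)⁻¹ := by
    intro z hz
    have hre : (z.re - p.re) ^ 2 ≤ ‖z - p‖ ^ 2 := by
      rw [← sq_abs (z.re - p.re), ← sub_re]
      gcongr
      exact abs_re_le_norm _
    have hq : 0 < 1 + (z.re - p.re) ^ 2 := by positivity
    rw [← div_eq_mul_inv]
    by_cases hzp : ‖z - p‖ ≤ δ
    · have h1 : ‖G z‖ ≤ M := hM z (by rwa [Metric.mem_closedBall, dist_eq_norm])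
      have h2 : ‖G z‖ ^ 2 ≤ M ^ 2 := by gcongr
      have h3 : M ^ 2 ≤ c / (1 + (z.re - p.re) ^ 2) := by
        rw [le_div_iff₀ hq]
        have : (z.re - p.re) ^ 2 ≤ δ ^ 2 := hre.trans (by gcongr)
        have h4 : 0 ≤ 2 * B ^ 2 * (1 + 1 / δ ^ 2) := by positivity
        have : M ^ 2 * (1 + (z.re - p.re) ^ 2) ≤ M ^ 2 * (1 + δ ^ 2) := by gcongr
        linarith
      have : 0 ≤ a * ‖F z‖ ^ 2 := by positivity
      linarith
    · push Not at hzp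
      have hd : 0 < ‖z - p‖ := hδ0.trans hzp
      have h1 := hbd z hz
      rw [norm_mul] at h1
      have h2 : ‖G z‖ ^ 2 * ‖z - p‖ ^ 2 ≤ 2 * ‖F z‖ ^ 2 + 2 * B ^ 2 := by
        rw [← mul_pow]
        have : (‖G z‖ * ‖z - p‖) ^ 2 ≤ (‖F z‖ + B) ^ 2 := by gcongr
        nlinarith [sq_nonneg (‖F z‖ - B)]
      have h3 : ‖G z‖ ^ 2 ≤ 2 * ‖F z‖ ^ 2 / ‖z - p‖ ^ 2 + 2 * B ^ 2 / ‖z - p‖ ^ 2 := by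
        rw [← add_div, le_div_iff₀ (by positivity)]
        exact h2
      have h4 : 2 * ‖F z‖ ^ 2 / ‖z - p‖ ^ 2 ≤ a * ‖F z‖ ^ 2 := by
        simp only [a]
        rw [div_mul_eq_mul_div]
        gcongr
      have h5 : 2 * B ^ 2 / ‖z - p‖ ^ 2 ≤ c / (1 + (z.re - p.re) ^ 2) := by
        rw [div_le_div_iff₀ (by positivity) hq]
        have h6 : 1 + (z.re - p.re) ^ 2 ≤ (1 + 1 / δ ^ 2) * ‖z - p‖ ^ 2 := by
          have : 1 ≤ 1 / δ ^ 2 * ‖z - p‖ ^ 2 := by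
            rw [one_div_mul_eq_div, one_le_div (by positivity)]
            gcongr
          linarith
        have h7 : 0 ≤ M ^ 2 * (1 + δ ^ 2) * ‖z - p‖ ^ 2 := by positivity
        calc 2 * B ^ 2 * (1 + (z.re - p.re) ^ 2)
            ≤ 2 * B ^ 2 * ((1 + 1 / δ ^ 2) * ‖z - p‖ ^ 2) := by gcongr
          _ ≤ c * ‖z - p‖ ^ 2 := by simp only [c]; linarith
      linarith
  obtain ⟨C, hC⟩ := hF.2
  refine ⟨hG, Real.toNNReal a * C + Real.toNNReal c * Real.toNNReal Real.pi, fun y hy => ?_⟩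
  calc ∫⁻ x : ℝ, ‖G ((x : ℂ) + (y : ℂ) * I)‖ₑ ^ 2
      ≤ ∫⁻ x : ℝ, (ENNReal.ofReal a * ‖F ((x : ℂ) + (y : ℂ) * I)‖ₑ ^ 2 +
          ENNReal.ofReal c * ENNReal.ofReal (1 + (x - p.re) ^ 2)⁻¹) := by
        refine lintegral_mono fun x => ?_
        have h1 := key ((x : ℂ) + (y : ℂ) * I) (by simpa [upperHalf] using hy)
        simp only [add_re, ofReal_re, mul_re, I_re, mul_zero, ofReal_im, I_im, mul_one,
          sub_zero, add_zero] at h1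
        rw [← ofReal_norm, ← ofReal_norm, ← ENNReal.ofReal_pow (norm_nonneg _),
          ← ENNReal.ofReal_pow (norm_nonneg _), ← ENNReal.ofReal_mul (by positivity),
          ← ENNReal.ofReal_mul hc, ← ENNReal.ofReal_add (by positivity) (by positivity)]
        exact ENNReal.ofReal_le_ofReal h1
    _ = ENNReal.ofReal a * (∫⁻ x : ℝ, ‖F ((x : ℂ) + (y : ℂ) * I)‖ₑ ^ 2) +
          ENNReal.ofReal c * ENNReal.ofReal Real.pi := by
        have hm : Measurable fun x : ℝ => ‖F ((x : ℂ) + (y : ℂ) * I)‖ₑ ^ 2 :=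
          (hF.continuous_horizontal hy).measurable.enorm.pow_const 2
        rw [lintegral_add_left (hm.const_mul _), lintegral_const_mul _ hm,
          lintegral_const_mul _ (by fun_prop), lintegral_inv_one_add_sq]
    _ ≤ _ := by
        push_cast
        simp only [ENNReal.ofReal]
        gcongr
        exact hC y hy

/-- The divided difference times `z - p` is `F z - F p`, so the pole at `p` is removed without
leaving `H²`. -/
theorem MemHardyTwo.dslope {F : ℂ → ℂ} (hF : MemHardyTwo F) {p : ℂ} (hp : p ∈ upperHalf) :
    MemHardyTwo (dslope F p) := by
  refine hF.of_norm_mul_sub_le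
    ((differentiableOn_dslope (isOpen_upperHalf.mem_nhds hp)).2 hF.1) hp (B := ‖F p‖) fun z _ => ?_
  have h := sub_smul_dslope F p z
  rw [smul_eq_mul] at h
  rw [mul_comm, h]
  exact norm_sub_le _ _

/-- Cauchy's formula on a horizontal line for `H²` functions. -/
theorem MemHardyTwo.integral_mul_inv_eq {F : ℂ → ℂ} (hF : MemHardyTwo F) {h : ℝ} (hh : 0 < h)
    {p : ℂ} (hp : h < p.im) :
    ∫ x : ℝ, F ((x : ℂ) + (h : ℂ) * I) * ((x : ℂ) + (h : ℂ) * I - p)⁻¹ =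
      2 * Real.pi * I * F p := by
  have hpu : p ∈ upperHalf := hh.trans hp
  set v := p.im - h with hv
  have hv0 : 0 < v := sub_pos.2 hp
  -- The reflection of `p` in the line: on the line, `(z - p)(z - q)` is the real quantity `(x - Re
  -- p)² + v²`.
  set q : ℂ := ⟨p.re, 2 * h - p.im⟩ with hq
  have hqh : q.im < h := by simp only [hq]; linarith
  have h1 := (hF.dslope hpu).integral_mul_inv_eq_zero hh hqh
  have h2 := hF.integral_mul_inv_eq_zero hh hqh
  obtain ⟨hi, he⟩ := integrable_and_integral_inv_sq_add_sq p.re hv0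
  have hz : ∀ x : ℝ, ((x : ℂ) + (h : ℂ) * I - p) ≠ 0 := fun x hx => by
    have := congrArg im hx
    simp at this
    linarith
  have hz' : ∀ x : ℝ, ((x : ℂ) + (h : ℂ) * I - q) ≠ 0 := fun x hx => by
    have := congrArg im hx
    simp [hq] at this
    linarith
  have hprod : ∀ x : ℝ, (((((x - p.re) ^ 2 + v ^ 2)⁻¹ : ℝ)) : ℂ) =
      ((x : ℂ) + (h : ℂ) * I - p)⁻¹ * ((x : ℂ) + (h : ℂ) * I - q)⁻¹ := by
    intro x
    rw [← mul_inv, ofReal_inv]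
    congr 1
    apply Complex.ext <;> (simp [hq, hv, pow_two]; ring)
  have hpq : p - q = 2 * v * I := by
    apply Complex.ext <;> (simp [hq, hv]; try ring)
  have hint : ∀ G : ℂ → ℂ, MemHardyTwo G →
      Integrable fun x : ℝ => G ((x : ℂ) + (h : ℂ) * I) * ((x : ℂ) + (h : ℂ) * I - q)⁻¹ := by
    intro G hG
    have hc := hG.continuous_horizontal hh
    obtain ⟨C, hC⟩ := hG.2
    refine integrable_mul_of_lintegral_sq_ne_top hc.measurable.aemeasurable
      (Measurable.aemeasurable (by fun_prop)) ((hC h hh).trans_lt ENNReal.coe_lt_top).ne ?_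
    rw [lintegral_enorm_inv_sub_sq q hqh]
    exact ENNReal.ofReal_ne_top
  -- Subtracting `F/(z - q)` makes every term integrable, since the divided difference alone is only
  -- square integrable on the line. The two terms with a pole at `q` integrate to zero by the
  -- previous case; the last contributes `2iv · F p · π/v`.
  have hdecomp : ∀ x : ℝ, F ((x : ℂ) + (h : ℂ) * I) * ((x : ℂ) + (h : ℂ) * I - p)⁻¹ =
      (p - q) * (_root_.dslope F p ((x : ℂ) + (h : ℂ) * I) * ((x : ℂ) + (h : ℂ) * I - q)⁻¹) +
      F ((x : ℂ) + (h : ℂ) * I) * ((x : ℂ) + (h : ℂ) * I - q)⁻¹ +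
      (p - q) * F p * (((((x - p.re) ^ 2 + v ^ 2)⁻¹ : ℝ)) : ℂ) := by
    intro x
    rw [hprod]
    have h3 := sub_smul_dslope F p ((x : ℂ) + (h : ℂ) * I)
    have hzx := hz x
    have hzx' := hz' x
    rw [smul_eq_mul, mul_comm] at h3
    rw [eq_div_of_mul_eq hzx h3]
    field_simp
    ring
  simp_rw [hdecomp]
  have hi1 := (hint _ (hF.dslope hpu)).const_mul (p - q)
  have hi2 : Integrable fun x : ℝ => (p - q) * F p * (((((x - p.re) ^ 2 + v ^ 2)⁻¹ : ℝ)) : ℂ) :=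
    hi.ofReal.const_mul _
  have hi3 : Integrable fun x : ℝ =>
      (p - q) * (_root_.dslope F p ((x : ℂ) + (h : ℂ) * I) * ((x : ℂ) + (h : ℂ) * I - q)⁻¹) +
      F ((x : ℂ) + (h : ℂ) * I) * ((x : ℂ) + (h : ℂ) * I - q)⁻¹ := hi1.add (hint _ hF)
  rw [integral_add hi3 hi2, integral_add hi1 (hint _ hF), integral_const_mul, h1, h2,
    integral_const_mul, integral_complex_ofReal, he, hpq]
  have : (v : ℂ) ≠ 0 := by exact_mod_cast hv0.ne'
  push_cast
  field_simp
  ring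

/-! ### Weak convergence and boundary values -/

/-- Fatou's bound for a limit of functions bounded in `L²`. -/
theorem lintegral_enorm_sq_le_of_tendsto {u : ℕ → ℝ → ℂ} {v : ℝ → ℂ} {C : ℝ≥0∞}
    (hu : ∀ n, AEMeasurable (u n)) (hC : ∀ n, ∫⁻ x, ‖u n x‖ₑ ^ 2 ≤ C)
    (hlim : ∀ᵐ x, Tendsto (fun n => u n x) atTop (𝓝 (v x))) :
    ∫⁻ x, ‖v x‖ₑ ^ 2 ≤ C := by
  calc ∫⁻ x, ‖v x‖ₑ ^ 2 = ∫⁻ x, liminf (fun n => ‖u n x‖ₑ ^ 2) atTop := by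
        refine lintegral_congr_ae (hlim.mono fun x hx => ?_)
        exact ((ENNReal.continuous_pow 2).tendsto _ |>.comp hx.enorm).liminf_eq.symm
    _ ≤ liminf (fun n => ∫⁻ x, ‖u n x‖ₑ ^ 2) atTop :=
        lintegral_liminf_le' fun n => (hu n).enorm.pow_const 2
    _ ≤ C := by
        refine (liminf_le_liminf (Eventually.of_forall hC)).trans ?_
        simp

/-- Bounded sequences in `L²` that converge almost everywhere converge weakly. -/
theorem tendsto_integral_mul_of_tendsto_ae {u : ℕ → ℝ → ℂ} {v g : ℝ → ℂ} {C : ℝ≥0∞} (hCtop : C ≠ ∞)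
    (hu : ∀ n, AEMeasurable (u n)) (hC : ∀ n, ∫⁻ x, ‖u n x‖ₑ ^ 2 ≤ C)
    (hlim : ∀ᵐ x, Tendsto (fun n => u n x) atTop (𝓝 (v x)))
    (hg : Measurable g) (hg0 : ∀ x, g x ≠ 0) (hg2 : ∫⁻ x, ‖g x‖ₑ ^ 2 ≠ ∞) :
    Tendsto (fun n => ∫ x, u n x * g x) atTop (𝓝 (∫ x, v x * g x)) := by
  have hv : AEMeasurable v := aemeasurable_of_tendsto_metrizable_ae _ hu hlim
  have hvC := lintegral_enorm_sq_le_of_tendsto hu hC hlim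
  have hint : ∀ w : ℝ → ℂ, AEMeasurable w → ∫⁻ x, ‖w x‖ₑ ^ 2 ≤ C →
      Integrable fun x => w x * g x := fun w hw hwC =>
    integrable_mul_of_lintegral_sq_ne_top hw hg.aemeasurable (hwC.trans_lt hCtop.lt_top).ne hg2
  refine tendsto_integral_of_L1 _ (hint v hv hvC).1
    (Eventually.of_forall fun n => hint _ (hu n) (hC n)) ?_
  have hd : ∀ n, AEMeasurable fun x => u n x - v x := fun n => (hu n).sub hv
  have hdC : ∀ n, ∫⁻ x, ‖u n x - v x‖ₑ ^ 2 ≤ 4 * C := by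
    intro n
    calc ∫⁻ x, ‖u n x - v x‖ₑ ^ 2 ≤ ∫⁻ x, (2 * ‖u n x‖ₑ ^ 2 + 2 * ‖v x‖ₑ ^ 2) := by
          refine lintegral_mono fun x => ?_
          have h : ‖u n x - v x‖ ^ 2 ≤ 2 * ‖u n x‖ ^ 2 + 2 * ‖v x‖ ^ 2 := by
            have h1 := norm_sub_le (u n x) (v x)
            have h2 : ‖u n x - v x‖ ^ 2 ≤ (‖u n x‖ + ‖v x‖) ^ 2 := by gcongr
            nlinarith [sq_nonneg (‖u n x‖ - ‖v x‖)]
          simp only [← ofReal_norm]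
          rw [← ENNReal.ofReal_pow (norm_nonneg _), ← ENNReal.ofReal_pow (norm_nonneg _),
            ← ENNReal.ofReal_pow (norm_nonneg _), ← ENNReal.ofReal_ofNat 2,
            ← ENNReal.ofReal_mul (by norm_num), ← ENNReal.ofReal_mul (by norm_num),
            ← ENNReal.ofReal_add (by positivity) (by positivity)]
          exact ENNReal.ofReal_le_ofReal h
      _ = 2 * (∫⁻ x, ‖u n x‖ₑ ^ 2) + 2 * ∫⁻ x, ‖v x‖ₑ ^ 2 := by
          rw [lintegral_add_left' (((hu n).enorm.pow_const 2).const_mul _),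
            lintegral_const_mul'' _ ((hu n).enorm.pow_const 2),
            lintegral_const_mul'' _ (hv.enorm.pow_const 2)]
      _ ≤ 2 * C + 2 * C := by gcongr; exact hC n
      _ = 4 * C := by ring
  have hgm : AEMeasurable g := hg.aemeasurable
  -- The part of `g` where `|u n - v|` exceeds `|g|`. Off that set the product `|u n - v| |g|` is
  -- dominated by `|g|²`. On it Cauchy–Schwarz applies, and `k n → 0` in `L²` by domination: as `g x
  -- ≠ 0`, almost every `x` eventually leaves the set.
  set k : ℕ → ℝ → ℂ := fun n x => {x | ‖g x‖ₑ < ‖u n x - v x‖ₑ}.indicator g x with hk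
  have hkm : ∀ n, AEMeasurable (k n) := fun n =>
    hgm.indicator₀ (nullMeasurableSet_lt hgm.enorm (hd n).enorm)
  have hsplit : ∀ n x, ‖u n x * g x - v x * g x‖ₑ ≤
      min ‖u n x - v x‖ₑ ‖g x‖ₑ * ‖g x‖ₑ + ‖(u n x - v x) * k n x‖ₑ := by
    intro n x
    rw [← sub_mul, enorm_mul, enorm_mul]
    by_cases hx : ‖g x‖ₑ < ‖u n x - v x‖ₑ
    · have : k n x = g x := Set.indicator_of_mem (s := {x | ‖g x‖ₑ < ‖u n x - v x‖ₑ}) hx g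
      rw [this]
      exact le_add_self
    · rw [min_eq_left (not_lt.1 hx)]
      exact le_self_add
  have hlimd : ∀ᵐ x, Tendsto (fun n => ‖u n x - v x‖ₑ) atTop (𝓝 0) :=
    hlim.mono fun x hx => by simpa using (hx.sub_const (v x)).enorm
  have hfirst : Tendsto (fun n => ∫⁻ x, min ‖u n x - v x‖ₑ ‖g x‖ₑ * ‖g x‖ₑ) atTop (𝓝 0) := by
    have := tendsto_lintegral_of_dominated_convergence' (μ := volume)
      (F := fun n x => min ‖u n x - v x‖ₑ ‖g x‖ₑ * ‖g x‖ₑ) (f := fun _ => 0)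
      (fun x => ‖g x‖ₑ ^ 2) (fun n => ((hd n).enorm.min hgm.enorm).mul hgm.enorm)
      (fun n => Eventually.of_forall fun x => by
        simp only [pow_two]; gcongr; exact min_le_right _ _) hg2
      (hlimd.mono fun x hx => by
        have h1 := hx.min (tendsto_const_nhds (x := ‖g x‖ₑ))
        have h2 := ENNReal.Tendsto.mul_const h1 (Or.inr (enorm_ne_top (x := g x)))
        simpa using h2)
    simpa using this
  have hsecond : Tendsto (fun n => ∫⁻ x, ‖k n x‖ₑ ^ 2) atTop (𝓝 0) := by
    have := tendsto_lintegral_of_dominated_convergence' (μ := volume)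
      (F := fun n x => ‖k n x‖ₑ ^ 2) (f := fun _ => 0)
      (fun x => ‖g x‖ₑ ^ 2) (fun n => (hkm n).enorm.pow_const 2)
      (fun n => Eventually.of_forall fun x => by
        exact pow_le_pow_left' (enorm_indicator_le_enorm_self _ _) 2) hg2
      (hlimd.mono fun x hx => by
        refine tendsto_const_nhds.congr' ?_
        filter_upwards [hx.eventually (gt_mem_nhds (enorm_pos.2 (hg0 x)))] with n hn
        have : k n x = 0 := Set.indicator_of_notMem
          (s := {x | ‖g x‖ₑ < ‖u n x - v x‖ₑ}) (not_lt.2 hn.le) g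
        simp [this])
    simpa using this
  have hsecond' : Tendsto (fun n => (4 * C) ^ (1 / 2 : ℝ) * (∫⁻ x, ‖k n x‖ₑ ^ 2) ^ (1 / 2 : ℝ))
      atTop (𝓝 0) := by
    have h2 := ((ENNReal.continuous_rpow_const (y := 1 / 2)).tendsto _).comp hsecond
    have h3 := ENNReal.Tendsto.const_mul (a := (4 * C) ^ (1 / 2 : ℝ)) h2
      (Or.inr (ENNReal.rpow_ne_top_of_nonneg (by norm_num) (ENNReal.mul_ne_top (by simp) hCtop)))
    simpa using h3
  have hsum := hfirst.add hsecond'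
  rw [add_zero] at hsum
  refine tendsto_of_tendsto_of_tendsto_of_le_of_le tendsto_const_nhds hsum
    (fun _ => bot_le) fun n => ?_
  calc ∫⁻ x, ‖u n x * g x - v x * g x‖ₑ
      ≤ ∫⁻ x, (min ‖u n x - v x‖ₑ ‖g x‖ₑ * ‖g x‖ₑ + ‖(u n x - v x) * k n x‖ₑ) :=
        lintegral_mono (hsplit n)
    _ = (∫⁻ x, min ‖u n x - v x‖ₑ ‖g x‖ₑ * ‖g x‖ₑ) + ∫⁻ x, ‖(u n x - v x) * k n x‖ₑ :=
        lintegral_add_left' (((hd n).enorm.min hgm.enorm).mul hgm.enorm) _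
    _ ≤ _ := by
        gcongr
        refine (lintegral_enorm_mul_le (hd n) (hkm n) le_rfl).trans ?_
        exact mul_le_mul_left (ENNReal.rpow_le_rpow (hdC n) (by norm_num)) _

/-- Cauchy's formula for the boundary values of an `H²` function. -/
theorem MemHardyTwo.boundary {F : ℂ → ℂ} (hF : MemHardyTwo F)
    (hlim : ∀ᵐ x : ℝ, ContinuousAt F x) :
    ∫⁻ x : ℝ, ‖F x‖ₑ ^ 2 ≠ ∞ ∧
      (∀ p : ℂ, p.im < 0 → ∫ x : ℝ, F x * ((x : ℂ) - p)⁻¹ = 0) ∧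
      ∀ p : ℂ, 0 < p.im → ∫ x : ℝ, F x * ((x : ℂ) - p)⁻¹ = 2 * Real.pi * I * F p := by
  obtain ⟨C, hC⟩ := hF.2
  set h : ℕ → ℝ := fun n => 1 / ((n : ℝ) + 1) with hh
  have hpos : ∀ n, 0 < h n := fun n => by simp only [hh]; positivity
  have htend : Tendsto h atTop (𝓝 0) := tendsto_one_div_add_atTop_nhds_zero_nat
  have htend' : ∀ p : ℂ, Tendsto (fun n => p + (h n : ℂ) * I) atTop (𝓝 p) := fun p => by
    have h1 : Tendsto (fun t : ℝ => p + (t : ℂ) * I) (𝓝 0) (𝓝 p) := by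
      have : Continuous fun t : ℝ => p + (t : ℂ) * I := by fun_prop
      simpa using this.tendsto 0
    exact h1.comp htend
  have hu : ∀ n, AEMeasurable fun x : ℝ => F ((x : ℂ) + (h n : ℂ) * I) := fun n =>
    (hF.continuous_horizontal (hpos n)).measurable.aemeasurable
  have hae : ∀ᵐ x : ℝ, Tendsto (fun n => F ((x : ℂ) + (h n : ℂ) * I)) atTop (𝓝 (F x)) :=
    hlim.mono fun x hx => hx.tendsto.comp (htend' x)
  have hkernel : ∀ p : ℂ, p.im ≠ 0 →
      Tendsto (fun n => ∫ x : ℝ, F ((x : ℂ) + (h n : ℂ) * I) * ((x : ℂ) - p)⁻¹) atTop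
        (𝓝 (∫ x : ℝ, F x * ((x : ℂ) - p)⁻¹)) := by
    intro p hp
    refine tendsto_integral_mul_of_tendsto_ae (C := C) ENNReal.coe_ne_top hu
      (fun n => hC _ (hpos n)) hae (by fun_prop) (fun x hx => ?_)
      (lintegral_enorm_inv_sub_sq_ne_top hp)
    rw [inv_eq_zero, sub_eq_zero] at hx
    exact hp (by simp [← hx])
  -- Raising the pole along with the line keeps the kernel `(x - p)⁻¹` fixed, so only the `H²`
  -- factor varies with `n`.
  have hshift : ∀ n (p : ℂ) (x : ℝ),
      ((x : ℂ) + (h n : ℂ) * I - (p + (h n : ℂ) * I)) = (x : ℂ) - p := fun n p x => by ring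
  refine ⟨?_, fun p hp => ?_, fun p hp => ?_⟩
  · exact ((lintegral_enorm_sq_le_of_tendsto hu (fun n => hC _ (hpos n)) hae).trans_lt
      ENNReal.coe_lt_top).ne
  · refine tendsto_nhds_unique (hkernel p hp.ne) (tendsto_const_nhds.congr fun n => ?_)
    have := hF.integral_mul_inv_eq_zero (hpos n) (p := p + (h n : ℂ) * I) (by simpa using hp)
    simp_rw [hshift] at this
    exact this.symm
  · refine tendsto_nhds_unique (hkernel p hp.ne') ?_
    have hcont : ContinuousAt F p := hF.1.continuousOn.continuousAt (isOpen_upperHalf.mem_nhds hp)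
    refine ((hcont.tendsto.comp (htend' p)).const_mul _).congr fun n => ?_
    have := hF.integral_mul_inv_eq (hpos n) (p := p + (h n : ℂ) * I) (by simpa using hp)
    simp_rw [hshift] at this
    exact this.symm

/-! ### The involution `#` and the real zeros of `E` -/

theorem sharp_sharp (f : ℂ → ℂ) : sharp (sharp f) = f := by
  funext z
  simp [sharp]

theorem sharp_ofReal (f : ℂ → ℂ) (t : ℝ) : sharp f t = conj (f t) := by
  simp [sharp]

theorem differentiable_sharp {f : ℂ → ℂ} (hf : Differentiable ℂ f) : Differentiable ℂ (sharp f) :=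
  fun z => differentiableAt_conj_conj_iff.2 (hf (conj z))

theorem sharp_mem_space {E f : ℂ → ℂ} (hf : f ∈ space E) : sharp f ∈ space E :=
  ⟨differentiable_sharp hf.1, hf.2.2, by rw [sharp_sharp]; exact hf.2.1⟩

theorem spaceNorm_sharp (E f : ℂ → ℂ) : spaceNorm E (sharp f) = spaceNorm E f := by
  have h : ∀ t : ℝ, ‖sharp f t / E t‖ₑ = ‖f t / E t‖ₑ := fun t => by
    rw [sharp_ofReal, ← ofReal_norm, ← ofReal_norm, norm_div, norm_div, norm_conj]
  simp_rw [spaceNorm, h]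

theorem HermiteBiehler.ne_zero {E : ℂ → ℂ} (hE : HermiteBiehler E) {z : ℂ} (hz : z ∈ upperHalf) :
    E z ≠ 0 := fun h => by
  have := hE.2 z hz
  rw [h, norm_zero] at this
  exact absurd this (not_lt.2 (norm_nonneg _))

/-- `E` may vanish at real points, but if it vanished on the whole line the identity theorem would
give `E = 0`. Real analyticity then makes the real zeros discrete, hence null, so quotients by `E`
are continuous at almost every real point. -/
theorem HermiteBiehler.ae_ne_zero {E : ℂ → ℂ} (hE : HermiteBiehler E) :
    ∀ᵐ t : ℝ, E t ≠ 0 := by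
  have han : AnalyticOnNhd ℂ E Set.univ := hE.1.differentiableOn.analyticOnNhd isOpen_univ
  have hreal : AnalyticOnNhd ℝ (fun t : ℝ => E t) Set.univ := fun t _ =>
    (han (t : ℂ) trivial).restrictScalars.comp (ofRealCLM.analyticAt t)
  rcases hreal.eqOn_zero_or_eventually_ne_zero_of_preconnected isPreconnected_univ with h | h
  · exfalso
    have hfreq : ∃ᶠ z in 𝓝[≠] (0 : ℂ), E z = 0 := by
      have h1 : Tendsto (fun t : ℝ => (t : ℂ)) (𝓝[≠] 0) (𝓝[≠] 0) := by
        refine tendsto_nhdsWithin_iff.2 ⟨?_, ?_⟩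
        · exact (continuous_ofReal.tendsto' 0 0 (by simp)).mono_left nhdsWithin_le_nhds
        · filter_upwards [self_mem_nhdsWithin] with t ht
          simpa using ht
      exact h1.frequently (Eventually.of_forall fun t => h (Set.mem_univ t)).frequently
    have := han.eqOn_zero_of_preconnected_of_frequently_eq_zero isPreconnected_univ trivial hfreq
    exact hE.ne_zero (z := I) (by simp [upperHalf]) (this trivial)
  · have h1 := ae_restrict_le_codiscreteWithin (μ := volume) MeasurableSet.univ h
    rwa [Measure.restrict_univ] at h1

theorem HermiteBiehler.ae_continuousAt_div {E f : ℂ → ℂ} (hE : HermiteBiehler E)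
    (hf : Differentiable ℂ f) : ∀ᵐ t : ℝ, ContinuousAt (fun z => f z / E z) t :=
  hE.ae_ne_zero.mono fun _ ht => hf.continuous.continuousAt.div hE.1.continuous.continuousAt ht

/-! ### The reproducing kernel -/

/-- The numerator `conj (E w) E - conj (E^# w) E^#` of the reproducing kernel. -/
noncomputable def kernelNumerator (E : ℂ → ℂ) (w : ℂ) : ℂ → ℂ :=
  fun s => conj (E w) * E s - E (conj w) * sharp E s

/-- The reproducing kernel of `H(E)` at `w`. -/
noncomputable def kernel (E : ℂ → ℂ) (w : ℂ) : ℂ → ℂ :=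
  fun z => I / (2 * Real.pi) * dslope (kernelNumerator E w) (conj w) z

theorem differentiable_kernelNumerator {E : ℂ → ℂ} (hE : Differentiable ℂ E) (w : ℂ) :
    Differentiable ℂ (kernelNumerator E w) :=
  (hE.const_mul _).sub ((differentiable_sharp hE).const_mul _)

theorem differentiable_kernel {E : ℂ → ℂ} (hE : Differentiable ℂ E) (w : ℂ) :
    Differentiable ℂ (kernel E w) := by
  refine Differentiable.const_mul ?_ _
  rw [← differentiableOn_univ, differentiableOn_dslope univ_mem, differentiableOn_univ]
  exact differentiable_kernelNumerator hE w

/-- The numerator vanishes at `conj w`, so the identity needs no exception at that point. -/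
theorem sub_mul_kernel (E : ℂ → ℂ) (w z : ℂ) :
    (z - conj w) * kernel E w z = I / (2 * Real.pi) * kernelNumerator E w z := by
  have h := sub_smul_dslope (kernelNumerator E w) (conj w) z
  have h0 : kernelNumerator E w (conj w) = 0 := by simp [kernelNumerator, sharp, mul_comm]
  rw [h0, sub_zero, smul_eq_mul] at h
  rw [kernel, ← h]
  ring

theorem norm_kernelNumerator_le {E : ℂ → ℂ} (w z : ℂ) :
    ‖kernelNumerator E w z‖ ≤ ‖E w‖ * ‖E z‖ + ‖E (conj w)‖ * ‖E (conj z)‖ := by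
  refine (norm_sub_le _ _).trans (le_of_eq ?_)
  simp [sharp]

theorem norm_I_div_two_pi_le : ‖I / (2 * Real.pi)‖ ≤ 1 := by
  rw [norm_div, norm_I, norm_mul, norm_real, Real.norm_of_nonneg Real.pi_pos.le, RCLike.norm_ofNat,
    div_le_one (by positivity)]
  linarith [Real.pi_gt_three]

theorem memHardyTwo_zero : MemHardyTwo fun _ => 0 :=
  ⟨differentiableOn_const _, 0, fun y _ => by simp⟩

/-- Since `|E(conj z)| < |E(z)|` above the axis, the numerator divided by `E` is bounded at `z`, and
so is its value at `conj z`. Both quotients are therefore `O(1/|z - w|)`, and the comparison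
criterion applies with `F = 0`. -/
theorem kernel_mem_space {E : ℂ → ℂ} (hE : HermiteBiehler E) {w : ℂ} (hw : w ∈ upperHalf) :
    kernel E w ∈ space E := by
  have hK := differentiable_kernel hE.1 w
  have hw0 : 0 < w.im := hw
  have hquot : ∀ f : ℂ → ℂ, Differentiable ℂ f →
      DifferentiableOn ℂ (fun z => f z / E z) upperHalf := fun f hf =>
    hf.differentiableOn.div hE.1.differentiableOn fun z hz => hE.ne_zero hz
  have hdiv : ∀ z ∈ upperHalf, ∀ a : ℂ, ‖a‖ ≤ ‖E w‖ * ‖E z‖ + ‖E (conj w)‖ * ‖E z‖ →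
      ‖I / (2 * Real.pi)‖ * ‖a‖ / ‖E z‖ ≤ ‖E w‖ + ‖E (conj w)‖ := by
    intro z hz a ha
    rw [div_le_iff₀ (norm_pos_iff.2 (hE.ne_zero hz)), add_mul]
    exact (mul_le_of_le_one_left (norm_nonneg _) norm_I_div_two_pi_le).trans ha
  refine ⟨hK, memHardyTwo_zero.of_norm_mul_sub_le (hquot _ hK) hw (B := ‖E w‖ + ‖E (conj w)‖) ?_,
    memHardyTwo_zero.of_norm_mul_sub_le (hquot _ (differentiable_sharp hK)) hw
      (B := ‖E w‖ + ‖E (conj w)‖) ?_⟩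
  · intro z hz
    have hz0 : 0 < z.im := hz
    have h1 : ‖z - w‖ ≤ ‖z - conj w‖ := by
      rw [← sq_le_sq₀ (norm_nonneg _) (norm_nonneg _), ← normSq_eq_norm_sq, ← normSq_eq_norm_sq,
        normSq_apply, normSq_apply]
      simp only [sub_re, sub_im, conj_re, conj_im]
      nlinarith [mul_pos hz0 hw0]
    rw [norm_zero, zero_add]
    calc ‖kernel E w z / E z * (z - w)‖ ≤ ‖(z - conj w) * kernel E w z‖ / ‖E z‖ := by
          rw [norm_mul, norm_div, norm_mul, div_mul_eq_mul_div, mul_comm]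
          gcongr
      _ = ‖I / (2 * Real.pi)‖ * ‖kernelNumerator E w z‖ / ‖E z‖ := by
          rw [sub_mul_kernel, norm_mul]
      _ ≤ _ := by
          refine hdiv z hz _ ((norm_kernelNumerator_le w z).trans ?_)
          gcongr
          exact (hE.2 z hz).le
  · intro z hz
    rw [norm_zero, zero_add]
    calc ‖sharp (kernel E w) z / E z * (z - w)‖
        = ‖(conj z - conj w) * kernel E w (conj z)‖ / ‖E z‖ := by
          rw [norm_mul, norm_div, norm_mul, div_mul_eq_mul_div, mul_comm, sharp, norm_conj,
            ← map_sub, norm_conj]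
      _ = ‖I / (2 * Real.pi)‖ * ‖kernelNumerator E w (conj z)‖ / ‖E z‖ := by
          rw [sub_mul_kernel, norm_mul]
      _ ≤ _ := by
          refine hdiv z hz _ ((norm_kernelNumerator_le w (conj z)).trans ?_)
          rw [conj_conj]
          gcongr
          exact (hE.2 z hz).le

theorem measurable_div_ofReal {E f : ℂ → ℂ} (hE : Differentiable ℂ E) (hf : Differentiable ℂ f) :
    Measurable fun t : ℝ => f t / E t :=
  (hf.continuous.comp continuous_ofReal).measurable.div
    (hE.continuous.comp continuous_ofReal).measurable

theorem HermiteBiehler.lintegral_ne_top {E f : ℂ → ℂ} (hE : HermiteBiehler E) (hf : f ∈ space E) :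
    ∫⁻ t : ℝ, ‖f t / E t‖ₑ ^ 2 ≠ ∞ :=
  (hf.2.1.boundary (hE.ae_continuousAt_div hf.1)).1

/-- The reproducing property of the kernel. -/
theorem HermiteBiehler.reproducing {E f : ℂ → ℂ} (hE : HermiteBiehler E) (hf : f ∈ space E) {z : ℂ}
    (hz : z ∈ upperHalf) :
    f z = ∫ t : ℝ, f t / E t * conj (kernel E z t / E t) := by
  have hz0 : 0 < z.im := hz
  obtain ⟨hfin₁, -, h₁⟩ := hf.2.1.boundary (hE.ae_continuousAt_div hf.1)
  obtain ⟨hfin₂, h₂, -⟩ := hf.2.2.boundary (hE.ae_continuousAt_div (differentiable_sharp hf.1))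
  specialize h₁ z hz0
  specialize h₂ (conj z) (by simpa using hz0)
  -- On the real line `conj (f^#/E)` equals `f / conj E`. This is where the Hardy condition on `f^#`
  -- enters: its Cauchy integral at the lower point `conj z` vanishes.
  have h₃ : ∫ t : ℝ, conj (sharp f t / E t) * ((t : ℂ) - z)⁻¹ = 0 := by
    rw [← map_zero (starRingEnd ℂ), ← h₂, ← integral_conj]
    simp
  have hk : AEMeasurable fun t : ℝ => ((t : ℂ) - z)⁻¹ := Measurable.aemeasurable (by fun_prop)
  have hi₁ : Integrable fun t : ℝ => f t / E t * ((t : ℂ) - z)⁻¹ :=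
    integrable_mul_of_lintegral_sq_ne_top (measurable_div_ofReal hE.1 hf.1).aemeasurable hk hfin₁
      (lintegral_enorm_inv_sub_sq_ne_top hz0.ne')
  have hi₃ : Integrable fun t : ℝ => conj (sharp f t / E t) * ((t : ℂ) - z)⁻¹ := by
    refine integrable_mul_of_lintegral_sq_ne_top ?_ hk ?_
      (lintegral_enorm_inv_sub_sq_ne_top hz0.ne')
    · exact (continuous_conj.measurable.comp
        (measurable_div_ofReal hE.1 (differentiable_sharp hf.1))).aemeasurable
    · simpa [← ofReal_norm] using hfin₂
  have hkey : ∀ t : ℝ, f t / E t * conj (kernel E z t / E t) =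
      -I / (2 * Real.pi) * (E z * (f t / E t * ((t : ℂ) - z)⁻¹) -
        conj (E (conj z)) * (conj (sharp f t / E t) * ((t : ℂ) - z)⁻¹)) := by
    intro t
    -- At a real zero of `E` both sides are zero because division by zero gives zero.
    by_cases ht : E t = 0
    · simp [ht]
    have htz : (t : ℂ) - z ≠ 0 := fun h => hz0.ne' (by simpa using congrArg im h)
    have htc : conj (E t) ≠ 0 := by simpa using ht
    have h := congrArg conj (sub_mul_kernel E z t)
    simp only [map_mul, map_sub, conj_ofReal, conj_conj, map_div₀, conj_I, kernelNumerator,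
      sharp_ofReal, map_ofNat] at h
    rw [mul_comm] at h
    rw [map_div₀, eq_div_of_mul_eq htz h, sharp_ofReal, map_div₀, conj_conj]
    field_simp
  simp_rw [hkey]
  rw [integral_const_mul, integral_sub (hi₁.const_mul _) (hi₃.const_mul _), integral_const_mul,
    integral_const_mul, h₁, h₃]
  have hEz := hE.ne_zero hz
  have hpi : (Real.pi : ℂ) ≠ 0 := by exact_mod_cast Real.pi_ne_zero
  field_simp
  linear_combination (f z * 2 * Real.pi) * I_sq

/-- The reproducing formula applied to the kernel itself: `K_z(z) = ‖K_z‖²`. -/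
theorem HermiteBiehler.spaceNorm_kernel {E : ℂ → ℂ} (hE : HermiteBiehler E) {z : ℂ}
    (hz : z ∈ upperHalf) :
    spaceNorm E (kernel E z) = ENNReal.ofReal ‖kernel E z z‖ ^ (1 / 2 : ℝ) := by
  have hmem := kernel_mem_space hE hz
  have h := hE.reproducing hmem hz
  have hm := measurable_div_ofReal hE.1 hmem.1
  simp_rw [mul_conj, normSq_eq_norm_sq] at h
  rw [integral_complex_ofReal] at h
  rw [h, norm_real, Real.norm_of_nonneg (integral_nonneg fun _ => by positivity), spaceNorm,
    ofReal_integral_eq_lintegral_ofReal _ (Eventually.of_forall fun _ => by positivity)]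
  · simp_rw [ENNReal.ofReal_pow (norm_nonneg _), ofReal_norm]
  · refine ⟨(hm.norm.pow_const 2).aestronglyMeasurable, ?_⟩
    simpa only [HasFiniteIntegral, enorm_pow, enorm_norm] using (hE.lintegral_ne_top hmem).lt_top

theorem HermiteBiehler.enorm_apply_le {E f : ℂ → ℂ} (hE : HermiteBiehler E) (hf : f ∈ space E)
    {z : ℂ} (hz : z ∈ upperHalf) : ‖f z‖ₑ ≤ spaceNorm E f * spaceNorm E (kernel E z) := by
  have hmem := kernel_mem_space hE hz
  rw [hE.reproducing hf hz]
  refine (enorm_integral_le_lintegral_enorm _).trans ?_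
  refine (lintegral_enorm_mul_le (measurable_div_ofReal hE.1 hf.1).aemeasurable
    (continuous_conj.measurable.comp (measurable_div_ofReal hE.1 hmem.1)).aemeasurable
    le_rfl).trans (le_of_eq ?_)
  simp [spaceNorm, ← ofReal_norm]

/-! ### Testing the composition operator on kernels -/

/-- The limit-free form `(‖E w‖² - ‖E (conj w)‖²) / Im w` of `4π` times the kernel's diagonal. -/
noncomputable def diagonal (E : ℂ → ℂ) (w : ℂ) : ℝ := (‖E w‖ ^ 2 - ‖E (conj w)‖ ^ 2) / w.im

theorem diagonal_conj (E : ℂ → ℂ) (w : ℂ) : diagonal E (conj w) = diagonal E w := by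
  rw [diagonal, diagonal, conj_conj, conj_im, div_neg, ← neg_div, neg_sub]

theorem HermiteBiehler.diagonal_pos {E : ℂ → ℂ} (hE : HermiteBiehler E) {w : ℂ}
    (hw : w ∈ upperHalf) : 0 < diagonal E w := by
  refine div_pos (sub_pos.2 ?_) hw
  have := hE.2 w hw
  gcongr

theorem HermiteBiehler.norm_kernel_self {E : ℂ → ℂ} (hE : HermiteBiehler E) {w : ℂ}
    (hw : w ∈ upperHalf) : ‖kernel E w w‖ = diagonal E w / (4 * Real.pi) := by
  have hw0 : 0 < w.im := hw
  have h := sub_mul_kernel E w w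
  have hN : kernelNumerator E w w = ((diagonal E w * w.im : ℝ) : ℂ) := by
    rw [diagonal, div_mul_cancel₀ _ hw0.ne']
    simp only [kernelNumerator, sharp, mul_comm (conj (E w)), mul_conj, normSq_eq_norm_sq]
    push_cast
    ring
  have hsub : w - conj w = ((2 * w.im : ℝ) : ℂ) * I := by
    apply Complex.ext <;> simp
    ring
  rw [hN, hsub] at h
  have h' := congrArg norm h
  rw [norm_mul, norm_mul, norm_mul, norm_div, norm_I, norm_mul, norm_real, norm_real, norm_real,
    RCLike.norm_ofNat, Real.norm_of_nonneg Real.pi_pos.le, Real.norm_of_nonneg (by positivity),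
    Real.norm_of_nonneg (mul_pos (hE.diagonal_pos hw) hw0).le] at h'
  have hpi := Real.pi_pos
  field_simp at h' ⊢
  linarith

theorem norm_sq_mul_defectQuotient {E : ℂ → ℂ} {w : ℂ} (hw : w.im ≠ 0) (h0 : E w ≠ 0) :
    ‖E w‖ ^ 2 * defectQuotient E w = diagonal E w := by
  have := norm_ne_zero_iff.2 h0
  rw [defectQuotient, if_neg hw, diagonal, chi, norm_div, sharp, norm_conj]
  field_simp

/-- Boundedness of the composition operator, tested on the kernels at `w`. -/
theorem HermiteBiehler.norm_sq_le_of_boundedComposition {E φ : ℂ → ℂ} (hE : HermiteBiehler E)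
    (hmaps : ∀ f ∈ space E, f ∘ φ ∈ space E) {C : ℝ≥0}
    (hC : ∀ f ∈ space E, spaceNorm E (f ∘ φ) ≤ C * spaceNorm E f) {z w : ℂ} (hz : z ∈ upperHalf)
    (hw : w ∈ upperHalf) {g : ℂ → ℂ} (hg : g ∈ space E)
    (hgn : spaceNorm E g = spaceNorm E (kernel E w)) :
    (4 * Real.pi * ‖g (φ z)‖) ^ 2 ≤ C ^ 2 * (diagonal E w * diagonal E z) := by
  have h1 := hE.enorm_apply_le (hmaps g hg) hz
  have h2 : ‖g (φ z)‖ₑ ≤ C * spaceNorm E (kernel E w) * spaceNorm E (kernel E z) :=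
    h1.trans (by rw [← hgn]; gcongr; exact hC g hg)
  rw [hE.spaceNorm_kernel hw, hE.spaceNorm_kernel hz, hE.norm_kernel_self hw,
    hE.norm_kernel_self hz] at h2
  have h3 : ‖g (φ z)‖ₑ ^ 2 ≤ (C : ℝ≥0∞) ^ 2 * ENNReal.ofReal (diagonal E w / (4 * Real.pi)) *
      ENNReal.ofReal (diagonal E z / (4 * Real.pi)) := by
    have hsq : ∀ a : ℝ≥0∞, (a ^ (1 / 2 : ℝ)) ^ 2 = a := fun a => by
      rw [← ENNReal.rpow_natCast, ← ENNReal.rpow_mul]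
      norm_num
    refine (pow_le_pow_left' h2 2).trans (le_of_eq ?_)
    rw [mul_pow, mul_pow, hsq, hsq]
  have hpi := Real.pi_pos
  have hdw := hE.diagonal_pos hw
  have hdz := hE.diagonal_pos hz
  have h4 : ‖g (φ z)‖ ^ 2 ≤ C ^ 2 * (diagonal E w / (4 * Real.pi)) *
      (diagonal E z / (4 * Real.pi)) := by
    rw [← ENNReal.ofReal_le_ofReal_iff (by positivity), ENNReal.ofReal_mul (by positivity),
      ENNReal.ofReal_mul (by positivity), ENNReal.ofReal_pow (norm_nonneg _),
      ENNReal.ofReal_pow (by positivity), ofReal_norm, ENNReal.ofReal_coe_nnreal]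
    exact h3
  calc (4 * Real.pi * ‖g (φ z)‖) ^ 2 = (4 * Real.pi) ^ 2 * ‖g (φ z)‖ ^ 2 := by ring
    _ ≤ (4 * Real.pi) ^ 2 * (C ^ 2 * (diagonal E w / (4 * Real.pi)) *
      (diagonal E z / (4 * Real.pi))) := by gcongr
    _ = _ := by field_simp

/-- Cancels one factor `a`; the case `a = 0` is kept because the limiting diagonal at a real point
is only known to be nonnegative. -/
theorem le_of_sq_le_mul {a b c : ℝ} (ha : 0 ≤ a) (hbc : 0 ≤ c * b) (h : a ^ 2 ≤ c * (a * b)) :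
    a ≤ c * b := by
  rcases ha.eq_or_lt with rfl | ha
  · exact hbc
  · refine le_of_mul_le_mul_left ?_ ha
    linarith

/-! ### Limits at real points -/

theorem tendsto_norm_div_of_hasDerivAt {f : ℝ → ℂ} {f' : ℂ} (hf : HasDerivAt f f' 0)
    (h0 : f 0 = 0) : Tendsto (fun ε : ℝ => ‖f ε‖ / ε) (𝓝[>] 0) (𝓝 ‖f'‖) := by
  have h := (hf.tendsto_slope_zero_right).norm
  refine h.congr' ?_
  filter_upwards [self_mem_nhdsWithin] with ε hε
  have hε' : 0 < ε := hε
  rw [zero_add, h0, sub_zero, norm_smul, norm_inv, Real.norm_of_nonneg hε'.le, div_eq_inv_mul]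

theorem hasDerivAt_comp_vertical {f : ℂ → ℂ} (hf : Differentiable ℂ f) (u : ℝ) (c : ℝ) :
    HasDerivAt (fun ε : ℝ => f (u + c * ε * I)) (deriv f u * (c * I)) 0 := by
  have h1 : HasDerivAt (fun ε : ℝ => (u : ℂ) + c * ε * I) (c * I) 0 := by
    simpa using (((hasDerivAt_id (0 : ℝ)).ofReal_comp.const_mul (c : ℂ)).mul_const I).const_add
      (u : ℂ)
  have h2 : HasDerivAt f (deriv f u) ((u : ℂ) + c * (0 : ℝ) * I) := by
    simpa using (hf u).hasDerivAt
  exact h2.comp 0 h1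

theorem norm_deriv_chi {E : ℂ → ℂ} (hE : Differentiable ℂ E) {u : ℝ} (h0 : E u ≠ 0) :
    ‖E u‖ ^ 2 * ‖deriv (chi E) u‖ = ‖deriv (sharp E) u * E u - sharp E u * deriv E u‖ := by
  have h : deriv (chi E) u = (deriv (sharp E) u * E u - sharp E u * deriv E u) / E u ^ 2 :=
    (((differentiable_sharp hE) u).hasDerivAt.div (hE u).hasDerivAt h0).deriv
  rw [h, norm_div, norm_pow, mul_div_cancel₀ _ (by simpa using h0)]

/-- Since `E^#(conj w) = conj E(w)`, the numerator of the diagonal is `E(w) E^#(conj w) - E(conj w)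
E^#(w)`. Along `w = u + iε` it is differentiable in `ε` and vanishes at `0`, so its quotient by `ε`
converges to a derivative, here a Wronskian of `E` and `E^#`. -/
theorem HermiteBiehler.tendsto_diagonal {E : ℂ → ℂ} (hE : HermiteBiehler E) (u : ℝ) :
    Tendsto (fun ε : ℝ => diagonal E (u + ε * I)) (𝓝[>] 0)
      (𝓝 (2 * ‖deriv (sharp E) u * E u - sharp E u * deriv E u‖)) := by
  have hS := differentiable_sharp hE.1
  have hd := ((hasDerivAt_comp_vertical hE.1 u 1).mul (hasDerivAt_comp_vertical hS u (-1))).sub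
    ((hasDerivAt_comp_vertical hE.1 u (-1)).mul (hasDerivAt_comp_vertical hS u 1))
  have h := tendsto_norm_div_of_hasDerivAt hd (by simp)
  have hval : ∀ a b c d : ℂ, ‖b * (((1 : ℝ) : ℂ) * I) * c + a * (d * (((-1 : ℝ) : ℂ) * I)) -
      (b * (((-1 : ℝ) : ℂ) * I) * c + a * (d * (((1 : ℝ) : ℂ) * I)))‖ = 2 * ‖d * a - c * b‖ := by
    intro a b c d
    have : b * (((1 : ℝ) : ℂ) * I) * c + a * (d * (((-1 : ℝ) : ℂ) * I)) -
      (b * (((-1 : ℝ) : ℂ) * I) * c + a * (d * (((1 : ℝ) : ℂ) * I))) =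
        -(2 * I * (d * a - c * b)) := by
      push_cast
      ring
    rw [this, norm_neg, norm_mul, norm_mul, norm_I, RCLike.norm_ofNat, mul_one]
  simp only [ofReal_zero, mul_zero, zero_mul, add_zero, hval] at h
  refine h.congr' ?_
  filter_upwards [self_mem_nhdsWithin] with ε hε
  have hε' : 0 < ε := hε
  have hw : ((u : ℂ) + ε * I) ∈ upperHalf := by simpa [upperHalf] using hε'
  have hpos := hE.diagonal_pos hw
  have him : ((u : ℂ) + ε * I).im = ε := by simp
  rw [← abs_of_pos hpos, diagonal, abs_div, him, abs_of_pos hε', ← Real.norm_eq_abs, ← norm_real]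
  congr 2
  simp only [Pi.sub_apply, Pi.mul_apply, sharp, map_add, map_mul, conj_ofReal, conj_I, ofReal_sub,
    ofReal_pow, ← mul_conj', ofReal_one, ofReal_neg, one_mul, neg_mul, mul_neg, map_neg, neg_neg]

/-- At the real point `u` the kernel's denominator is `iε`, and its numerator `E^#(u - iε) E(u) -
E(u - iε) E^#(u)` vanishes at `ε = 0`. The limit agrees with that of the diagonal, which is what
allows cancellation at real `φ(z)`. -/
theorem HermiteBiehler.tendsto_norm_kernel {E : ℂ → ℂ} (hE : HermiteBiehler E) (u : ℝ) :
    Tendsto (fun ε : ℝ => 4 * Real.pi * ‖kernel E (u + ε * I) u‖) (𝓝[>] 0)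
      (𝓝 (2 * ‖deriv (sharp E) u * E u - sharp E u * deriv E u‖)) := by
  have hS := differentiable_sharp hE.1
  have hd := ((hasDerivAt_comp_vertical hS u (-1)).mul_const (E u)).sub
    ((hasDerivAt_comp_vertical hE.1 u (-1)).mul_const (sharp E u))
  have h := (tendsto_norm_div_of_hasDerivAt hd (by simp [mul_comm])).const_mul 2
  have hval : deriv (sharp E) u * (((-1 : ℝ) : ℂ) * I) * E u -
      deriv E u * (((-1 : ℝ) : ℂ) * I) * sharp E u =
        -(I * (deriv (sharp E) u * E u - sharp E u * deriv E u)) := by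
    push_cast
    ring
  rw [hval, norm_neg, norm_mul, norm_I, one_mul] at h
  refine h.congr' ?_
  filter_upwards [self_mem_nhdsWithin] with ε hε
  have hε' : 0 < ε := hε
  have hc : conj ((u : ℂ) + ε * I) = u + ((-1 : ℝ) : ℂ) * ε * I := by simp
  have hk := sub_mul_kernel E (u + ε * I) u
  have hsub : (u : ℂ) - conj ((u : ℂ) + ε * I) = ε * I := by
    simp
  have hN : kernelNumerator E (u + ε * I) u =
      sharp E (u + ((-1 : ℝ) : ℂ) * ε * I) * E u - E (u + ((-1 : ℝ) : ℂ) * ε * I) * sharp E u := by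
    have hs : sharp E (conj ((u : ℂ) + ε * I)) = conj (E (u + ε * I)) := by
      simp only [sharp, conj_conj]
    rw [kernelNumerator, ← hc, hs]
  rw [hsub, hN] at hk
  have hk' := congrArg norm hk
  rw [norm_mul, norm_mul, norm_mul, norm_div, norm_I, norm_mul, norm_real, norm_real,
    RCLike.norm_ofNat, Real.norm_of_nonneg Real.pi_pos.le, Real.norm_of_nonneg hε'.le] at hk'
  have hpi := Real.pi_pos
  simp only [Pi.sub_apply]
  field_simp at hk' ⊢
  linarith

/-! ### The bound for each position of `φ(z)` -/

theorem HermiteBiehler.norm_sq_mul_defectQuotient_le {E φ : ℂ → ℂ} (hE : HermiteBiehler E)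
    (hmaps : ∀ f ∈ space E, f ∘ φ ∈ space E) {C : ℝ≥0}
    (hC : ∀ f ∈ space E, spaceNorm E (f ∘ φ) ≤ C * spaceNorm E f) {z : ℂ} (hz : z ∈ upperHalf)
    (h0 : E (φ z) ≠ 0) :
    ‖E (φ z)‖ ^ 2 * defectQuotient E (φ z) ≤ C ^ 2 * diagonal E z := by
  have hdz := hE.diagonal_pos hz
  have hpi := Real.pi_pos
  rcases lt_trichotomy (φ z).im 0 with hw | hw | hw
  · have hwc : conj (φ z) ∈ upperHalf := by simpa [upperHalf] using hw
    rw [norm_sq_mul_defectQuotient hw.ne h0, ← diagonal_conj]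
    have hdw := hE.diagonal_pos hwc
    have h := hE.norm_sq_le_of_boundedComposition hmaps hC hz hwc
      (sharp_mem_space (kernel_mem_space hE hwc)) (spaceNorm_sharp _ _)
    rw [sharp, norm_conj, hE.norm_kernel_self hwc, mul_div_cancel₀ _ (by positivity)] at h
    exact le_of_sq_le_mul hdw.le (by positivity) h
  · obtain ⟨u, hu⟩ : ∃ u : ℝ, φ z = u := ⟨(φ z).re, by apply Complex.ext <;> simp [hw]⟩
    have hR : ‖E (φ z)‖ ^ 2 * defectQuotient E (φ z) =
        2 * ‖deriv (sharp E) u * E u - sharp E u * deriv E u‖ := by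
      rw [hu] at h0 ⊢
      rw [← norm_deriv_chi hE.1 h0, defectQuotient, if_pos (ofReal_im u)]
      ring
    rw [hR]
    refine le_of_sq_le_mul (by positivity) (by positivity) ?_
    -- With `D` the common limit, the tested inequalities at `u + iε` pass to `D² ≤ C² · D ·
    -- diagonal E z`.
    refine le_of_tendsto_of_tendsto ((hE.tendsto_norm_kernel u).pow 2)
      (((hE.tendsto_diagonal u).mul_const (diagonal E z)).const_mul ((C : ℝ) ^ 2)) ?_
    filter_upwards [self_mem_nhdsWithin] with ε hε
    have hw' : ((u : ℂ) + ε * I) ∈ upperHalf := by simpa [upperHalf] using hε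
    have h := hE.norm_sq_le_of_boundedComposition hmaps hC hz hw' (kernel_mem_space hE hw') rfl
    rwa [hu] at h
  · rw [norm_sq_mul_defectQuotient hw.ne' h0]
    have hdw := hE.diagonal_pos hw
    have h := hE.norm_sq_le_of_boundedComposition hmaps hC hz hw (kernel_mem_space hE hw) rfl
    rw [hE.norm_kernel_self hw, mul_div_cancel₀ _ (by positivity)] at h
    exact le_of_sq_le_mul hdw.le (by positivity) h

theorem HermiteBiehler.weight_le {E φ : ℂ → ℂ} (hE : HermiteBiehler E)
    (hmaps : ∀ f ∈ space E, f ∘ φ ∈ space E) {C : ℝ≥0}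
    (hC : ∀ f ∈ space E, spaceNorm E (f ∘ φ) ≤ C * spaceNorm E f) {z : ℂ} (hz : z ∈ upperHalf)
    (h0 : E (φ z) ≠ 0) : weight E φ z ≤ C ^ 2 := by
  have hz0 : 0 < z.im := hz
  have hEz := norm_pos_iff.2 (hE.ne_zero hz)
  -- `|E(z)|² (1 - |χ(z)|²) / Im z` is the diagonal at `z`, so the remaining factors of the weight
  -- form its denominator.
  have h1 : weight E φ z = ‖E (φ z)‖ ^ 2 * defectQuotient E (φ z) / diagonal E z := by
    rw [← norm_sq_mul_defectQuotient hz0.ne' (hE.ne_zero hz), weight]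
    conv_rhs => rw [defectQuotient.eq_def E z, if_neg hz0.ne']
    rw [norm_div]
    field_simp
  rw [h1, div_le_iff₀ (hE.diagonal_pos hz)]
  exact hE.norm_sq_mul_defectQuotient_le hmaps hC hz h0

end DeBranges

theorem theorem3p4 (E φ : ℂ → ℂ) (hE : DeBranges.HermiteBiehler E)
    (hφ : Differentiable ℂ φ) :
    (DeBranges.BoundedComposition E φ →
      BddAbove (DeBranges.weight E φ '' DeBranges.regularSet E φ)) ∧
    ((∀ z ∈ DeBranges.upperHalf, φ z ∈ DeBranges.upperHalf) →
      DeBranges.regularSet E φ = DeBranges.upperHalf) := by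
  refine ⟨fun ⟨hmaps, C, hC⟩ => ⟨C ^ 2, ?_⟩, fun h => ?_⟩
  · rintro _ ⟨z, hz, rfl⟩
    exact hE.weight_le hmaps hC hz.1 hz.2
  · exact Set.Subset.antisymm (fun z hz => hz.1) fun z hz => ⟨hz, hE.ne_zero (h z hz)⟩
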